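/- **Theorem 1.4.** Let $n$ be a nonnegative integer and let $(S^n,g_0)$ be the round $n$-sphere of constant sectional curvature one, regarded as the unit sphere in $\mathbb{R}^{n+1}$ with the induced metric; let $x^0,\dotsc,x^n$ be (the restrictions to $S^n$ of) the standard coordinates on $\mathbb{R}^{n+1}$. Let $\nabla$ be the gradient and $\delta=\operatorname{tr}\nabla$ the divergence (on one-forms, using the Levi-Civita connection) of $g_0$, let $\Delta=\delta d$, and write $\Delta u^2=\Delta(u^2)$. Let $L_{\sigma_2}\colon\bigl(C^\infty(S^n)\bigr)^3\to C^\infty(S^n)$ be the $\sigma_2$-operator of $g_0$, i.e. the symmetric trilinear operator (polarization) determined by $$ L_{\sigma_2}(u,u,u) = \frac{1}{2}\delta\left(|\nabla u|^2\,du\right) - \frac{n-4}{16}\left( u\Delta|\nabla u|^2 - \delta\left((\Delta u^2)\,du\right)\right) - \frac{n-1}{4}\left(\frac{n-4}{4}\right)^2u\Delta u^2 + \frac{n(n-1)}{8}\left(\frac{n-4}{4}\right)^3u^3 . $$ Then $$ \sum_{i=0}^n x^i[L_{\sigma_2},x^i](u,u,u) = \frac{n-1}{3}\,u\,\sigma_1(u)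 $$ for all $u\in C^\infty(S^n)$, where $$ [L_{\sigma_2},x^i](u,u,u) := L_{\sigma_2}(x^iu,u,u) - x^iL_{\sigma_2}(u,u,u) $$ and $$ \sigma_1(u) := -\frac{n-4}{8}\Delta u^2 - |\nabla u|^2 + \frac{n}{2}\left(\frac{n-4}{4}\right)^2u^2 . $$ -/

import Mathlib

open scoped Manifold ContDiff

noncomputable section

namespace RoundSphere

/-- The ambient Euclidean space `ℝ^{n+1}`. -/
abbrev Amb (n : ℕ) : Type := EuclideanSpace ℝ (Fin (n + 1))

/-- The unit sphere `S^n ⊂ ℝ^{n+1}`, with the smooth structure given by Mathlib. -/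
abbrev Sph (n : ℕ) : Type := Metric.sphere (0 : Amb n) 1

/-- The tangent space `T_p S^n`. -/
abbrev Tan {n : ℕ} (p : Sph n) : Type := TangentSpace (𝓡 n) p

/-- `f ∈ C^∞(S^n)`. -/
def IsSmooth {n : ℕ} (f : Sph n → ℝ) : Prop := ContMDiff (𝓡 n) 𝓘(ℝ, ℝ) ∞ f

/-- The differential of the inclusion `ι : S^n → ℝ^{n+1}` at `p`, identifying `T_p S^n` with the
hyperplane orthogonal to `p`. -/
def dIncl {n : ℕ} (p : Sph n) : Tan p →L[ℝ] Amb n :=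
  mvfderiv (𝓡 n) (Subtype.val : Sph n → Amb n) p

/-- The round metric `g₀ = ι^* ⟨·,·⟩`, of constant sectional curvature one. -/
def metric {n : ℕ} (p : Sph n) : LinearMap.BilinForm ℝ (Tan p) :=
  (innerₗ (Amb n)).compl₁₂ (dIncl p).toLinearMap (dIncl p).toLinearMap

theorem metric_apply {n : ℕ} (p : Sph n) (v w : Tan p) :
    metric p v w = inner ℝ (dIncl p v) (dIncl p w) := rfl

theorem metric_nondegenerate {n : ℕ} (p : Sph n) : (metric p).Nondegenerate := by
  have : Fact (Module.finrank ℝ (Amb n) = n + 1) := ⟨finrank_euclideanSpace_fin⟩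
  have key : ∀ v : Tan p, metric p v v = 0 → v = 0 := by
    intro v hv
    rw [metric_apply, inner_self_eq_zero] at hv
    refine injective_mvfderiv_subtypeVal_sphere p ?_
    exact hv.trans (map_zero (dIncl p)).symm
  exact ⟨fun v hv => key v (hv v), fun v hv => key v (hv v)⟩

instance {n : ℕ} (p : Sph n) : FiniteDimensional ℝ (Tan p) :=
  inferInstanceAs (FiniteDimensional ℝ (EuclideanSpace ℝ (Fin n)))

/-- The musical isomorphism `♯ : T_p^* S^n → T_p S^n`: the vector `α^♯` is characterized by
`g₀(α^♯, w) = α(w)` for all `w`. -/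
def sharp {n : ℕ} (p : Sph n) (α : Module.Dual ℝ (Tan p)) : Tan p :=
  ((metric p).toDual (metric_nondegenerate p)).symm α

theorem metric_sharp {n : ℕ} (p : Sph n) (α : Module.Dual ℝ (Tan p)) (w : Tan p) :
    metric p (sharp p α) w = α w :=
  LinearMap.BilinForm.apply_toDual_symm_apply α w

/-- The orthogonal projection `ℝ^{n+1} → T_p S^n`: the tangent vector `e^⊤` is characterized by
`⟨dι e^⊤, dι w⟩ = ⟨e, dι w⟩` for all `w ∈ T_p S^n`. -/
def tangentialPart {n : ℕ} (p : Sph n) : Amb n →ₗ[ℝ] Tan p :=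
  ((metric p).toDual (metric_nondegenerate p)).symm.toLinearMap ∘ₗ
    (innerₗ (Amb n)).compl₂ (dIncl p).toLinearMap

theorem inner_tangentialPart {n : ℕ} (p : Sph n) (e : Amb n) (w : Tan p) :
    inner ℝ (dIncl p (tangentialPart p e)) (dIncl p w) = inner ℝ e (dIncl p w) :=
  LinearMap.BilinForm.apply_toDual_symm_apply (B := metric p) (hB := metric_nondegenerate p)
    ((innerₗ (Amb n)).compl₂ (dIncl p).toLinearMap e) w

/-- The Levi-Civita connection `v ↦ ∇_v X` of the round metric at `p`: the tangential part of the
derivative of the vector field `X`, regarded as an `ℝ^{n+1}`-valued function, in direction `v`. -/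
def connection {n : ℕ} (X : ∀ q : Sph n, Tan q) (p : Sph n) : Tan p →ₗ[ℝ] Tan p :=
  tangentialPart p ∘ₗ (mvfderiv (𝓡 n) (fun q : Sph n => dIncl q (X q)) p).toLinearMap

/-- The divergence `δX = tr ∇X` of a vector field. -/
def divergence {n : ℕ} (X : ∀ q : Sph n, Tan q) (p : Sph n) : ℝ :=
  LinearMap.trace ℝ (Tan p) (connection X p)

/-- The differential `df` of a function. -/
def differential {n : ℕ} (f : Sph n → ℝ) (p : Sph n) : Module.Dual ℝ (Tan p) :=
  (mvfderiv (𝓡 n) f p).toLinearMap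

/-- The gradient `∇f = (df)^♯`. -/
def grad {n : ℕ} (f : Sph n → ℝ) (p : Sph n) : Tan p := sharp p (differential f p)

/-- `|∇f|² = g₀(∇f, ∇f)`. -/
def gradNormSq {n : ℕ} (f : Sph n → ℝ) (p : Sph n) : ℝ := metric p (grad f p) (grad f p)

/-- The divergence `δα = tr ∇(α^♯)` of a one-form. -/
def formDivergence {n : ℕ} (α : ∀ q : Sph n, Module.Dual ℝ (Tan q)) (p : Sph n) : ℝ :=
  divergence (fun q => sharp q (α q)) p

/-- The Laplacian `Δf = δ(df)`, a nonpositive operator. -/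
def laplacian {n : ℕ} (f : Sph n → ℝ) (p : Sph n) : ℝ := formDivergence (differential f) p

/-- The cubic differential operator `u ↦ L_{σ₂}(u,u,u)`:
`½ δ(|∇u|² du) - (n-4)/16 (u Δ|∇u|² - δ((Δu²) du)) - (n-1)/4 ((n-4)/4)² u Δu²
  + n(n-1)/8 ((n-4)/4)³ u³`. -/
def sigmaTwoCubic {n : ℕ} (u : Sph n → ℝ) (p : Sph n) : ℝ :=
  (1 / 2) * formDivergence (fun q => gradNormSq u q • differential u q) p
    - ((n : ℝ) - 4) / 16 *
      (u p * laplacian (gradNormSq u) p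
        - formDivergence (fun q => laplacian (u ^ 2) q • differential u q) p)
    - ((n : ℝ) - 1) / 4 * (((n : ℝ) - 4) / 4) ^ 2 * (u p * laplacian (u ^ 2) p)
    + (n : ℝ) * ((n : ℝ) - 1) / 8 * (((n : ℝ) - 4) / 4) ^ 3 * u p ^ 3

/-- The polarization of a cubic form `F`: the unique symmetric trilinear map
`(u, v, w) ↦ T(u, v, w)` such that `T(u, u, u) = F(u)`. -/
def polarization {n : ℕ} (F : (Sph n → ℝ) → Sph n → ℝ) (u v w : Sph n → ℝ) : Sph n → ℝ :=
  (1 / 6 : ℝ) • (F (u + v + w) - F (u + v) - F (v + w) - F (u + w) + F u + F v + F w)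

/-- The `σ₂`-operator `L_{σ₂}(u, v, w)`, symmetric and trilinear on `C^∞(S^n)`. -/
def sigmaTwoOp {n : ℕ} (u v w : Sph n → ℝ) : Sph n → ℝ := polarization sigmaTwoCubic u v w

/-- The operator `σ₁(u) = -(n-4)/8 Δu² - |∇u|² + (n/2) ((n-4)/4)² u²`. -/
def sigmaOne {n : ℕ} (u : Sph n → ℝ) (p : Sph n) : ℝ :=
  -(((n : ℝ) - 4) / 8) * laplacian (u ^ 2) p - gradNormSq u p
    + (n : ℝ) / 2 * (((n : ℝ) - 4) / 4) ^ 2 * u p ^ 2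

/-- The restriction to `S^n` of the `i`-th standard coordinate of `ℝ^{n+1}`. -/
def coord {n : ℕ} (i : Fin (n + 1)) (p : Sph n) : ℝ := (p : Amb n) i

/-- The commutator `[L, x](u, u, u) = L(x u, u, u) - x L(u, u, u)`. -/
def commutator {n : ℕ} (L : (Sph n → ℝ) → (Sph n → ℝ) → (Sph n → ℝ) → Sph n → ℝ)
    (x u : Sph n → ℝ) : Sph n → ℝ :=
  L (x * u) u u - x * L u u u

end RoundSphere

end

/-! Let `D i` be differentiation along the tangential part of `e_i`, i.e. along `∇xⁱ`. On the sphere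
`|∇u|² = ∑ (D i u)²` and `Δ = ∑ (D i)²`, and the only facts needed about the geometry are `∑ xⁱxⁱ =
1`, `∑ xⁱ D i = 0` and `D i xʲ = δᵢⱼ - xⁱxʲ`. The theorem thus becomes an identity in a commutative
algebra with derivations (`SphereFrame`). There, `L_{σ₂}(xⁱu,u,u)` is one third of the sum of a
non-symmetric trilinear form over the three positions of `xⁱu`. Contracting with `xⁱ` reproduces the
form itself, plus corrections from derivatives that fall on `xⁱ`. The corrections are governed by
`Δxⁱ = -n xⁱ` and by differentiating `∑ xⁱ D i u = 0` (`sum_coord_mul_apply_apply`,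
`sum_coord_mul_lap_apply`). The total, `sum_coord_mul_trilin`, leaves only multiples of `u|∇u|²`,
`u²Δu` and `u³`, which match `u σ₁(u)`. The geometric input is `formDivergence_eq_sum` together with
`isSmooth_frameDeriv`. -/

noncomputable section

namespace RoundSphere

/-- Derivations `D i` and elements `x i` of a commutative algebra that satisfy the relations between
the tangential parts of the standard basis vectors of Euclidean space and the coordinate functions
on the unit sphere. -/
structure SphereFrame {A ι : Type*} [CommRing A] [Algebra ℝ A] [Fintype ι] [DecidableEq ι]
    (x : ι → A) (D : ι → Derivation ℝ A A) : Prop where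
  sum_mul_self : ∑ i, x i * x i = 1
  sum_mul_apply : ∀ f, ∑ i, x i * D i f = 0
  apply_coord : ∀ i j, D i (x j) = (if i = j then 1 else 0) - x i * x j

/-! ### Calculus with derivations satisfying the sphere relations -/

section Algebra

variable {A ι : Type*} [CommRing A] [Algebra ℝ A] [Fintype ι] (D : ι → Derivation ℝ A A)

/-- The carré du champ `∑ (D i f) (D i g)` of a family of derivations. -/
def gam (f g : A) : A := ∑ i, D i f * D i g

/-- The second order operator `∑ (D i)²` of a family of derivations. -/
def lap (f : A) : A := ∑ i, D i (D i f)

theorem gam_comm (f g : A) : gam D f g = gam D g f := by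
  simp only [gam, mul_comm]

theorem gam_add_left (f g h : A) : gam D (f + g) h = gam D f h + gam D g h := by
  simp only [gam, map_add, add_mul, Finset.sum_add_distrib]

theorem gam_add_right (f g h : A) : gam D f (g + h) = gam D f g + gam D f h := by
  simp only [gam, map_add, mul_add, Finset.sum_add_distrib]

theorem gam_mul_left (f g h : A) : gam D (f * g) h = f * gam D g h + g * gam D f h := by
  simp only [gam, Derivation.leibniz, smul_eq_mul, Finset.mul_sum, ← Finset.sum_add_distrib]
  exact Finset.sum_congr rfl fun i _ => by ring

theorem gam_sub_left (f g h : A) : gam D (f - g) h = gam D f h - gam D g h := by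
  simp only [gam, map_sub, sub_mul, Finset.sum_sub_distrib]

theorem lap_add (f g : A) : lap D (f + g) = lap D f + lap D g := by
  simp only [lap, map_add, Finset.sum_add_distrib]

theorem lap_mul (f g : A) : lap D (f * g) = f * lap D g + g * lap D f + 2 * gam D f g := by
  simp only [lap, gam, Derivation.leibniz, smul_eq_mul, map_add, Finset.mul_sum,
    ← Finset.sum_add_distrib]
  exact Finset.sum_congr rfl fun i _ => by ring

/-- A trilinear form whose restriction to the diagonal is the `σ₂`-operator. -/
def trilin (a b c d u v w : A) : A :=
  a * (gam D u v * lap D w + gam D (gam D u v) w)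
    - b * (u * lap D (gam D v w) - (lap D (u * v) * lap D w + gam D (lap D (u * v)) w))
    - c * (u * lap D (v * w)) + d * (u * v * w)

/-- The alternating sum is the sum of the form over all six orderings of `v, u, u`; each position of
`v` occurs twice, whence the factor 2. -/
theorem trilin_polarization (a b c d u v : A) :
    (trilin D a b c d (v + u + u) (v + u + u) (v + u + u) - trilin D a b c d (v + u) (v + u) (v + u)
      - trilin D a b c d (u + u) (u + u) (u + u) - trilin D a b c d (v + u) (v + u) (v + u)
      + trilin D a b c d v v v + trilin D a b c d u u u + trilin D a b c d u u u) =
    2 * (trilin D a b c d v u u + trilin D a b c d u v u + trilin D a b c d u u v) := by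
  simp only [trilin, gam_add_left, gam_add_right, lap_add, add_mul, mul_add]
  ring

variable {D} [DecidableEq ι] {x : ι → A}

namespace SphereFrame

variable (hx : SphereFrame x D)
include hx

/-- The matrix `D j (x i)` is the orthogonal projection along `x`, so it fixes every family `φ` with
`∑ x i * φ i = 0`. -/
theorem sum_apply_coord_mul (j : ι) (φ : ι → A) :
    ∑ i, D j (x i) * φ i = φ j - x j * ∑ i, x i * φ i := by
  simp only [hx.apply_coord, sub_mul, ite_mul, one_mul, zero_mul, Finset.sum_sub_distrib,
    Finset.sum_ite_eq, Finset.mem_univ, if_true, Finset.mul_sum, mul_assoc]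

theorem gam_coord (i : ι) (f : A) : gam D (x i) f = D i f := by
  have h : ∀ j, D j (x i) = D i (x j) := fun j => by
    rw [hx.apply_coord, hx.apply_coord, mul_comm]
    simp only [eq_comm]
  simp only [gam, h, hx.sum_apply_coord_mul, hx.sum_mul_apply, mul_zero, sub_zero]

/-- With `n + 1` coordinates the eigenvalue is `-n`: these are the first spherical harmonics. -/
theorem lap_coord (i : ι) : lap D (x i) = (1 - (Fintype.card ι : A)) * x i := by
  have h1 : ∀ j, D j (D j (x i)) = -(x j * D j (x i)) - x i * (1 - x j * x j) := fun j => by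
    rw [hx.apply_coord j i, map_sub, Derivation.leibniz]
    have : D j (if j = i then (1 : A) else 0) = 0 := by split_ifs <;> simp
    rw [this, hx.apply_coord j i, hx.apply_coord j j]
    simp only [smul_eq_mul, if_true]
    ring
  simp only [lap, h1, Finset.sum_sub_distrib, Finset.sum_neg_distrib, hx.sum_mul_apply,
    ← Finset.mul_sum, hx.sum_mul_self, Finset.sum_const, Finset.card_univ, nsmul_eq_mul]
  ring

/-- Apply `D j` to `∑ x i * D i u = 0`; the terms where `D j` hits `x i` add up to `D j u`. -/
theorem sum_coord_mul_apply_apply (j : ι) (u : A) : ∑ i, x i * D j (D i u) = -D j u := by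
  have h := congrArg (D j) (hx.sum_mul_apply u)
  simp only [map_sum, Derivation.leibniz, smul_eq_mul, map_zero, Finset.sum_add_distrib] at h
  have h2 : ∑ i, D i u * D j (x i) = D j u := by
    simpa only [mul_comm, hx.sum_mul_apply, mul_zero, sub_zero] using
      hx.sum_apply_coord_mul j fun i => D i u
  rw [h2] at h
  exact eq_neg_of_add_eq_zero_left h

theorem sum_coord_mul_gam_apply (h u : A) : ∑ i, x i * gam D (D i u) h = -gam D u h := by
  simp only [gam, Finset.mul_sum]
  rw [Finset.sum_comm, ← Finset.sum_neg_distrib]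
  refine Finset.sum_congr rfl fun j _ => ?_
  simp only [← mul_assoc, ← Finset.sum_mul, hx.sum_coord_mul_apply_apply, neg_mul]

/-- A second application of `D j` leaves an extra `x j * D j u`, which disappears only after summing
over `j`. -/
theorem sum_coord_mul_lap_apply (u : A) : ∑ i, x i * lap D (D i u) = -2 * lap D u := by
  have key : ∀ j, ∑ i, x i * D j (D j (D i u)) = -2 * D j (D j u) - x j * D j u := fun j => by
    have h := congrArg (D j) (hx.sum_coord_mul_apply_apply j u)
    simp only [map_sum, Derivation.leibniz, smul_eq_mul, map_neg, Finset.sum_add_distrib] at h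
    have h2 := hx.sum_apply_coord_mul j fun i => D j (D i u)
    simp only [hx.sum_coord_mul_apply_apply, mul_comm (D j (x _))] at h2
    rw [h2] at h
    linear_combination h
  simp only [lap, Finset.mul_sum]
  rw [Finset.sum_comm]
  simp only [key, Finset.sum_sub_distrib, hx.sum_mul_apply, sub_zero]

theorem sum_coord_mul_gam_coord_mul (h g : A) : ∑ i, x i * gam D (x i * h) g = gam D h g := by
  calc ∑ i, x i * gam D (x i * h) g
      = (∑ i, x i * x i) * gam D h g + h * ∑ i, x i * D i g := by
        simp only [gam_mul_left, hx.gam_coord, Finset.mul_sum, Finset.sum_mul,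
          ← Finset.sum_add_distrib]
        exact Finset.sum_congr rfl fun i _ => by ring
    _ = gam D h g := by rw [hx.sum_mul_self, hx.sum_mul_apply]; ring

theorem sum_coord_mul_lap_coord_mul (h : A) :
    ∑ i, x i * lap D (x i * h) = lap D h + (1 - (Fintype.card ι : A)) * h := by
  calc ∑ i, x i * lap D (x i * h)
      = (∑ i, x i * x i) * (lap D h + (1 - (Fintype.card ι : A)) * h)
          + 2 * ∑ i, x i * D i h := by
        simp only [lap_mul, hx.gam_coord, hx.lap_coord, Finset.mul_sum, Finset.sum_mul,
          ← Finset.sum_add_distrib]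
        exact Finset.sum_congr rfl fun i _ => by ring
    _ = _ := by rw [hx.sum_mul_self, hx.sum_mul_apply]; ring

theorem sum_coord_mul_gam_mul_apply (h u g : A) :
    ∑ i, x i * gam D (h * D i u) g = -(h * gam D u g) := by
  calc ∑ i, x i * gam D (h * D i u) g
      = h * ∑ i, x i * gam D (D i u) g + gam D h g * ∑ i, x i * D i u := by
        simp only [gam_mul_left, Finset.mul_sum, ← Finset.sum_add_distrib]
        exact Finset.sum_congr rfl fun i _ => by ring
    _ = _ := by rw [hx.sum_coord_mul_gam_apply, hx.sum_mul_apply]; ring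

theorem sum_coord_mul_lap_mul_apply (h u : A) :
    ∑ i, x i * lap D (h * D i u) = -2 * (h * lap D u) - 2 * gam D h u := by
  calc ∑ i, x i * lap D (h * D i u)
      = h * ∑ i, x i * lap D (D i u) + lap D h * ∑ i, x i * D i u
          + 2 * ∑ i, x i * gam D (D i u) h := by
        simp only [lap_mul, gam_comm D h, Finset.mul_sum, ← Finset.sum_add_distrib]
        exact Finset.sum_congr rfl fun i _ => by ring
    _ = _ := by
        rw [hx.sum_coord_mul_gam_apply, hx.sum_mul_apply, hx.sum_coord_mul_lap_apply,
          gam_comm D u h]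
        ring

theorem gam_coord_mul (i : ι) (u : A) :
    gam D (x i * u) u = x i * gam D u u + u * D i u := by
  rw [gam_mul_left, hx.gam_coord]

theorem gam_lap_coord_mul (i : ι) (h g : A) :
    gam D (lap D (x i * h)) g = gam D (x i * lap D h) g
      + (1 - (Fintype.card ι : A)) * gam D (x i * h) g + 2 * gam D (D i h) g := by
  -- The eigenvalue and the factor 2 now stand inside a derivation, so their constancy is used.
  have hc : ∀ k : ℕ, gam D (k : A) g = 0 := fun k => by simp [gam]
  have h2 : gam D (2 : A) g = 0 := by simpa using hc 2
  have h1 : gam D (1 : A) g = 0 := by simp [gam]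
  rw [lap_mul, hx.gam_coord, hx.lap_coord]
  simp only [gam_add_left, gam_mul_left, gam_sub_left, hc, h2, h1]
  ring

theorem sum_coord_mul_gam_lap_coord_mul (h g : A) :
    ∑ i, x i * gam D (lap D (x i * h)) g =
      gam D (lap D h) g - (1 + (Fintype.card ι : A)) * gam D h g := by
  calc ∑ i, x i * gam D (lap D (x i * h)) g
      = ∑ i, x i * gam D (x i * lap D h) g
          + (1 - (Fintype.card ι : A)) * ∑ i, x i * gam D (x i * h) g
          + 2 * ∑ i, x i * gam D (D i h) g := by
        simp only [hx.gam_lap_coord_mul, Finset.mul_sum, ← Finset.sum_add_distrib]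
        exact Finset.sum_congr rfl fun i _ => by ring
    _ = _ := by
        simp only [hx.sum_coord_mul_gam_coord_mul, hx.sum_coord_mul_gam_apply]
        ring

/-- The polarization of the `σ₂`-operator at `(x i * u, u, u)`, contracted with `x i`. -/
theorem sum_coord_mul_trilin (a b c d u : A) (m : A) (hm : (Fintype.card ι : A) = m + 1) :
    ∑ i, x i * (trilin D a b c d (x i * u) u u + trilin D a b c d u (x i * u) u
        + trilin D a b c d u u (x i * u)) =
      3 * trilin D a b c d u u u - a * ((m + 2) * (u * gam D u u))
        - b * ((4 * m + 4) * (u * gam D u u) + (4 * m - 4) * (u ^ 2 * lap D u))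
        + 2 * c * m * u ^ 3 := by
  set N := gam D u u with hN
  set L := lap D (u * u) with hL
  have hLu : L = 2 * (u * lap D u) + 2 * N := by rw [hL, lap_mul]; ring
  have huu : gam D (u * u) u = 2 * (u * N) := by rw [gam_mul_left]; ring
  have expand : ∀ i, trilin D a b c d (x i * u) u u + trilin D a b c d u (x i * u) u
      + trilin D a b c d u u (x i * u) =
      a * (2 * ((x i * N + u * D i u) * lap D u
            + (gam D (x i * N) u + gam D (u * D i u) u))
          + (N * lap D (x i * u) + gam D (x i * u) N))
      - b * (x i * (u * lap D N) + 2 * (u * (lap D (x i * N) + lap D (u * D i u)))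
          - 2 * (lap D (x i * (u * u)) * lap D u + gam D (lap D (x i * (u * u))) u)
          - (L * lap D (x i * u) + gam D (x i * u) L))
      - c * (x i * (u * L) + 2 * (u * lap D (x i * (u * u)))) + 3 * (d * (x i * (u * u * u))) :=
    fun i => by
      have e1 : u * (x i * u) = x i * (u * u) := by ring
      have e2 : x i * u * u = x i * (u * u) := by ring
      simp only [trilin, gam_comm D u (x i * u), gam_comm D _ (x i * u), hx.gam_coord_mul, e1, e2,
        gam_add_left, lap_add, ← hN, ← hL]
      ring
  have split : ∑ i, x i * (trilin D a b c d (x i * u) u u + trilin D a b c d u (x i * u) u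
        + trilin D a b c d u u (x i * u)) =
      a * (2 * ((N * (∑ i, x i * x i) + u * ∑ i, x i * D i u) * lap D u
            + (∑ i, x i * gam D (x i * N) u + ∑ i, x i * gam D (u * D i u) u))
          + (N * ∑ i, x i * lap D (x i * u) + ∑ i, x i * gam D (x i * u) N))
      - b * ((∑ i, x i * x i) * (u * lap D N)
          + 2 * (u * (∑ i, x i * lap D (x i * N) + ∑ i, x i * lap D (u * D i u)))
          - 2 * ((∑ i, x i * lap D (x i * (u * u))) * lap D u
            + ∑ i, x i * gam D (lap D (x i * (u * u))) u)
          - (L * ∑ i, x i * lap D (x i * u) + ∑ i, x i * gam D (x i * u) L))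
      - c * ((∑ i, x i * x i) * (u * L) + 2 * (u * ∑ i, x i * lap D (x i * (u * u))))
      + 3 * (d * ((∑ i, x i * x i) * (u * u * u))) := by
    simp only [expand, Finset.mul_sum, Finset.sum_mul, ← Finset.sum_add_distrib,
      ← Finset.sum_sub_distrib]
    exact Finset.sum_congr rfl fun i _ => by ring
  rw [split, hx.sum_mul_self, hx.sum_mul_apply]
  simp only [hx.sum_coord_mul_gam_coord_mul, hx.sum_coord_mul_lap_coord_mul,
    hx.sum_coord_mul_gam_mul_apply, hx.sum_coord_mul_lap_mul_apply,
    hx.sum_coord_mul_gam_lap_coord_mul, huu, hm, trilin, ← hN, ← hL]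
  -- `Δu²` stays atomic until the contractions are done; expanding it puts the remainder in terms of
  -- `|∇u|²` and `Δu`.
  rw [gam_comm D u N, gam_comm D u L, hLu]
  ring

end SphereFrame

end Algebra

/-! ### Tangential projection, chain rules and extension off the sphere -/

variable {n : ℕ}

instance fact_finrank_amb : Fact (Module.finrank ℝ (Amb n) = n + 1) := ⟨finrank_euclideanSpace_fin⟩

theorem IsSmooth.mdifferentiableAt {f : Sph n → ℝ} (hf : IsSmooth f) (p : Sph n) :
    MDifferentiableAt (𝓡 n) 𝓘(ℝ, ℝ) f p :=
  (hf p).mdifferentiableAt (by simp)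

theorem mdifferentiableAt_incl (p : Sph n) :
    MDifferentiableAt (𝓡 n) 𝓘(ℝ, Amb n) (Subtype.val : Sph n → Amb n) p :=
  (contMDiff_coe_sphere (m := 1) p).mdifferentiableAt one_ne_zero

theorem inner_self_sphere (p : Sph n) : inner ℝ (p : Amb n) (p : Amb n) = 1 := by
  rw [real_inner_self_eq_norm_sq, norm_eq_of_mem_sphere p, one_pow]

theorem range_dIncl (p : Sph n) : (dIncl p).range = (Submodule.span ℝ {(p : Amb n)})ᗮ :=
  range_mvfderiv_subtypeVal p

/-- The right side is orthogonal to `p`, hence tangent; its difference from the left side is tangent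
and orthogonal to all tangent vectors, itself included. -/
theorem dIncl_tangentialPart (p : Sph n) (e : Amb n) :
    dIncl p (tangentialPart p e) = e - inner ℝ (p : Amb n) e • (p : Amb n) := by
  have h : e - inner ℝ (p : Amb n) e • (p : Amb n) ∈ (dIncl p).range := by
    rw [range_dIncl, Submodule.mem_orthogonal_singleton_iff_inner_right, inner_sub_right,
      inner_smul_right, inner_self_sphere, mul_one, sub_self]
  have horth : ∀ w, inner ℝ (p : Amb n) (dIncl p w) = 0 := fun w => by
    have hw : dIncl p w ∈ (dIncl p).range := ⟨w, rfl⟩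
    rw [range_dIncl] at hw
    exact Submodule.mem_orthogonal_singleton_iff_inner_right.1 hw
  obtain ⟨w, hw⟩ := h
  replace hw : dIncl p w = e - inner ℝ (p : Amb n) e • (p : Amb n) := hw
  rw [← hw, ← sub_eq_zero, ← inner_self_eq_zero (𝕜 := ℝ), ← map_sub]
  have h1 : ∀ v, inner ℝ (dIncl p (tangentialPart p e - w)) (dIncl p v) = 0 := fun v => by
    rw [map_sub, inner_sub_left, inner_tangentialPart, hw, inner_sub_left, inner_smul_left, horth]
    simp
  exact h1 _

theorem mvfderiv_comp_incl {F : Type*} [NormedAddCommGroup F] [NormedSpace ℝ F] {U : Amb n → F}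
    {p : Sph n} (hU : DifferentiableAt ℝ U p) (w : Tan p) :
    mvfderiv (𝓡 n) (fun q : Sph n => U q) p w = fderiv ℝ U p (dIncl p w) := by
  have h := mfderiv_comp_apply (I := 𝓡 n) (I' := 𝓘(ℝ, Amb n)) (I'' := 𝓘(ℝ, F)) (g := U)
    (f := (Subtype.val : Sph n → Amb n)) p hU.mdifferentiableAt (mdifferentiableAt_incl p) w
  rw [mfderiv_eq_fderiv] at h
  exact h

theorem clm_comp_mvfderiv {F : Type*} [NormedAddCommGroup F] [NormedSpace ℝ F] (l : F →L[ℝ] ℝ)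
    {Y : Sph n → F} {p : Sph n} (hY : MDifferentiableAt (𝓡 n) 𝓘(ℝ, F) Y p) (w : Tan p) :
    mvfderiv (𝓡 n) (fun q => l (Y q)) p w = l (mvfderiv (𝓡 n) Y p w) := by
  have h := mfderiv_comp_apply (I := 𝓡 n) (I' := 𝓘(ℝ, F)) (I'' := 𝓘(ℝ, ℝ)) (g := l)
    (f := Y) p l.differentiableAt.mdifferentiableAt hY w
  rw [mfderiv_eq_fderiv, l.fderiv] at h
  exact h

/-- A smooth function on the sphere extends to the ambient space, smoothly away from the origin. -/
theorem IsSmooth.exists_extension {f : Sph n → ℝ} (hf : IsSmooth f) :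
    ∃ U : Amb n → ℝ, (∀ q : Sph n, U q = f q) ∧ ∀ q : Sph n, ContDiffAt ℝ ∞ U q := by
  classical
  let O : TopologicalSpace.Opens (Amb n) := ⟨{0}ᶜ, isOpen_compl_singleton⟩
  have hO : ∀ y : O, (y : Amb n) ≠ 0 := fun y => y.2
  have hmem : ∀ y : O, ‖(y : Amb n)‖⁻¹ • (y : Amb n) ∈ Metric.sphere (0 : Amb n) 1 := fun y => by
    rw [mem_sphere_zero_iff_norm, norm_smul, norm_inv, norm_norm,
      inv_mul_cancel₀ (norm_ne_zero_iff.2 (hO y))]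
  have hr : ContMDiff 𝓘(ℝ, Amb n) 𝓘(ℝ, Amb n) ∞
      fun y : O => ‖(y : Amb n)‖⁻¹ • (y : Amb n) := fun y => by
    refine (contMDiffAt_subtype_iff (U := O) (f := fun z : Amb n => ‖z‖⁻¹ • z) (x := y)).2
      (ContDiffAt.contMDiffAt ?_)
    exact ((contDiffAt_norm ℝ (hO y)).inv (norm_ne_zero_iff.2 (hO y))).smul contDiffAt_id
  have hR : ContMDiff 𝓘(ℝ, Amb n) (𝓡 n) ∞ (Set.codRestrict _ _ hmem : O → Sph n) :=
    ContMDiff.codRestrict_sphere (n := n) hr hmem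
  -- The extension is homogeneous of degree zero; its value at the origin is irrelevant.
  let U : Amb n → ℝ := fun y => if hy : y ≠ 0 then f ⟨_, hmem ⟨y, hy⟩⟩ else 0
  have hne : ∀ q : Sph n, (q : Amb n) ≠ 0 := ne_zero_of_mem_unit_sphere
  refine ⟨U, fun q => ?_, fun q => ?_⟩
  · simp only [U, dif_pos (hne q)]
    congr 1
    ext1
    simp [norm_eq_of_mem_sphere q]
  · refine (contMDiffAt_subtype_iff (U := O) (f := U) (x := ⟨q, hne q⟩)).1 ?_ |>.contDiffAt
    have : (fun y : O => U y) = f ∘ Set.codRestrict _ _ hmem := by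
      funext y
      simp only [U, dif_pos (hO y)]
      rfl
    rw [this]
    exact (hf.comp hR) _

/-! ### Gradient and divergence in terms of the frame derivatives -/

/-- The standard basis of the ambient space. -/
def basisVec (i : Fin (n + 1)) : Amb n := EuclideanSpace.basisFun (Fin (n + 1)) ℝ i

theorem inner_basisVec (i : Fin (n + 1)) (v : Amb n) : inner ℝ (basisVec i) v = v i :=
  EuclideanSpace.basisFun_inner _ _ v i

/-- The derivative of `f` in the direction of the tangential part of the `i`-th standard basis
vector. -/
def frameDeriv (i : Fin (n + 1)) (f : Sph n → ℝ) (p : Sph n) : ℝ :=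
  mvfderiv (𝓡 n) f p (tangentialPart p (basisVec i))

/-- For an extension `U`, the function is the restriction of `y ↦ dU_y(e_i - ⟨y, e_i⟩ y)`, smooth
near the sphere; no charts are needed. -/
theorem isSmooth_frameDeriv {f : Sph n → ℝ} (hf : IsSmooth f) (i : Fin (n + 1)) :
    IsSmooth (frameDeriv i f) := by
  obtain ⟨U, hUf, hU⟩ := hf.exists_extension
  let G : Amb n → ℝ := fun y => fderiv ℝ U y (basisVec i - inner ℝ y (basisVec i) • y)
  have hG : frameDeriv i f = fun q : Sph n => G q := by
    funext q
    have h1 : f = fun q : Sph n => U q := funext fun q => (hUf q).symm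
    rw [frameDeriv, h1, mvfderiv_comp_incl ((hU q).differentiableAt (by simp)),
      dIncl_tangentialPart]
  have hGs : ∀ q : Sph n, ContDiffAt ℝ ∞ G q := fun q => by
    have h1 : ContDiffAt ℝ ∞ (fderiv ℝ U) (q : Amb n) := (hU q).fderiv_right (by simp)
    exact h1.clm_apply (contDiffAt_const.sub
      ((contDiffAt_id.inner ℝ contDiffAt_const).smul contDiffAt_id))
  rw [hG]
  exact fun q => (hGs q).comp_contMDiffAt (contMDiff_coe_sphere q)

theorem isSmooth_coord (i : Fin (n + 1)) : IsSmooth (coord i : Sph n → ℝ) := by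
  have h : (coord i : Sph n → ℝ) = fun q : Sph n => inner ℝ (basisVec i) (q : Amb n) :=
    funext fun q => (inner_basisVec i _).symm
  rw [h]
  exact (innerSL ℝ (basisVec i : Amb n)).contMDiff.comp contMDiff_coe_sphere

theorem mvfderiv_coord (i : Fin (n + 1)) (p : Sph n) (w : Tan p) :
    mvfderiv (𝓡 n) (coord i) p w = inner ℝ (basisVec i) (dIncl p w) := by
  have h : (coord i : Sph n → ℝ) = fun q : Sph n => innerSL ℝ (basisVec i) (q : Amb n) :=
    funext fun q => (inner_basisVec i _).symm
  rw [h, clm_comp_mvfderiv _ (mdifferentiableAt_incl p)]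
  rfl

theorem frameDeriv_coord (i j : Fin (n + 1)) (p : Sph n) :
    frameDeriv i (coord j) p = (if i = j then 1 else 0) - coord i p * coord j p := by
  rw [frameDeriv, mvfderiv_coord, dIncl_tangentialPart, inner_sub_right, inner_smul_right,
    inner_basisVec, inner_basisVec, real_inner_comm, inner_basisVec, basisVec,
    EuclideanSpace.basisFun_apply]
  simp [coord, eq_comm]

theorem sum_coord_mul_self (p : Sph n) : ∑ i, coord i p * coord i p = 1 := by
  have h := inner_self_sphere p
  rw [← (EuclideanSpace.basisFun (Fin (n + 1)) ℝ).sum_inner_mul_inner] at h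
  rw [← h]
  refine Finset.sum_congr rfl fun i _ => ?_
  rw [real_inner_comm, EuclideanSpace.basisFun_inner]
  rfl

theorem apply_dIncl_sharp (p : Sph n) (α : Module.Dual ℝ (Tan p)) (i : Fin (n + 1)) :
    inner ℝ (basisVec i) (dIncl p (sharp p α)) = α (tangentialPart p (basisVec i)) := by
  rw [← metric_sharp, metric_apply, ← inner_tangentialPart, real_inner_comm]

theorem gradNormSq_eq_sum (f : Sph n → ℝ) (p : Sph n) :
    gradNormSq f p = ∑ i, frameDeriv i f p * frameDeriv i f p := by
  rw [gradNormSq, metric_apply, ← (EuclideanSpace.basisFun (Fin (n + 1)) ℝ).sum_inner_mul_inner]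
  refine Finset.sum_congr rfl fun i _ => ?_
  rw [real_inner_comm]
  exact congrArg₂ (· * ·) (apply_dIncl_sharp p _ i) (apply_dIncl_sharp p _ i)

theorem sum_coord_mul_frameDeriv (f : Sph n → ℝ) (p : Sph n) :
    ∑ i, coord i p * frameDeriv i f p = 0 := by
  have h0 : tangentialPart p (p : Amb n) = 0 := by
    apply injective_mvfderiv_subtypeVal_sphere p
    refine Eq.trans ?_ (map_zero (dIncl p)).symm
    refine (dIncl_tangentialPart p p).trans ?_
    rw [inner_self_sphere, one_smul, sub_self]
  have hp : ∑ i, coord i p • (basisVec i : Amb n) = p := by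
    have := (EuclideanSpace.basisFun (Fin (n + 1)) ℝ).sum_repr (p : Amb n)
    exact this
  have h1 : ∑ i, coord i p * frameDeriv i f p =
      mvfderiv (𝓡 n) f p (tangentialPart p (∑ i, coord i p • (basisVec i : Amb n))) := by
    simp only [map_sum, map_smul, smul_eq_mul, frameDeriv]
  rw [h1, hp, h0, map_zero]

theorem formDivergence_eq_sum (α : ∀ q : Sph n, Module.Dual ℝ (Tan q))
    (hα : ∀ i, IsSmooth fun q => α q (tangentialPart q (basisVec i))) (p : Sph n) :
    formDivergence α p =
      ∑ i, frameDeriv i (fun q => α q (tangentialPart q (basisVec i))) p := by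
  set Y : Sph n → Amb n := fun q => dIncl q (sharp q (α q)) with hY
  have hYs : ContMDiff (𝓡 n) 𝓘(ℝ, Amb n) ∞ Y := by
    have : Y = fun q => ∑ i, α q (tangentialPart q (basisVec i)) • (basisVec i : Amb n) := by
      funext q
      simp only [← apply_dIncl_sharp, inner_basisVec]
      exact ((EuclideanSpace.basisFun (Fin (n + 1)) ℝ).sum_repr (Y q)).symm
    rw [this]
    exact contMDiff_finsetSum fun i _ => (hα i).smul contMDiff_const
  have hYd : MDifferentiableAt (𝓡 n) 𝓘(ℝ, Amb n) Y p := (hYs p).mdifferentiableAt (by simp)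
  -- Cyclicity moves the trace from `T_p S^n` to the ambient space, where the standard basis
  -- replaces an orthonormal frame.
  rw [formDivergence, divergence, connection, LinearMap.trace_comp_comm',
    LinearMap.trace_eq_sum_inner _ (EuclideanSpace.basisFun (Fin (n + 1)) ℝ)]
  refine Finset.sum_congr rfl fun i _ => ?_
  have h1 : (fun q => α q (tangentialPart q (basisVec i))) =
      fun q => innerSL ℝ (basisVec i) (Y q) := funext fun q => (apply_dIncl_sharp q _ i).symm
  rw [h1, frameDeriv, clm_comp_mvfderiv _ hYd]
  rfl

theorem laplacian_eq_sum {f : Sph n → ℝ} (hf : IsSmooth f) (p : Sph n) :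
    laplacian f p = ∑ i, frameDeriv i (frameDeriv i f) p :=
  formDivergence_eq_sum _ (fun i => isSmooth_frameDeriv hf i) p

theorem formDivergence_smul_differential {f g : Sph n → ℝ} (hf : IsSmooth f) (hg : IsSmooth g)
    (p : Sph n) :
    formDivergence (fun q => f q • differential g q) p =
      ∑ i, frameDeriv i (f * frameDeriv i g) p :=
  formDivergence_eq_sum (fun q => f q • differential g q) (fun i => hf.mul (isSmooth_frameDeriv hg i)) p

/-! ### Transfer to the algebra of smooth functions -/

/-- The algebra `C^∞(S^n)`. -/
abbrev SmoothFn (n : ℕ) : Type := C^∞⟮𝓡 n, Sph n; ℝ⟯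

/-- `frameDeriv i` as a derivation of `C^∞(S^n)`. -/
def frameDerivation (i : Fin (n + 1)) : Derivation ℝ (SmoothFn n) (SmoothFn n) :=
  Derivation.mk'
    { toFun := fun f => ⟨frameDeriv i f, isSmooth_frameDeriv f.contMDiff i⟩
      map_add' := fun f g => by
        ext p
        change mvfderiv (𝓡 n) (f + g : Sph n → ℝ) p _ = _
        rw [mvfderiv_add (IsSmooth.mdifferentiableAt f.contMDiff p)
          (IsSmooth.mdifferentiableAt g.contMDiff p)]
        rfl
      map_smul' := fun r f => by
        ext p
        exact clm_comp_mvfderiv (r • ContinuousLinearMap.id ℝ ℝ)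
          (IsSmooth.mdifferentiableAt f.contMDiff p) _ }
    fun f g => by
      ext p
      change mvfderiv (𝓡 n) (f * g : Sph n → ℝ) p _ = _
      rw [mvfderiv_mul (IsSmooth.mdifferentiableAt f.contMDiff p)
        (IsSmooth.mdifferentiableAt g.contMDiff p)]
      rfl

/-- The coordinate functions as elements of `C^∞(S^n)`. -/
def coordFn (i : Fin (n + 1)) : SmoothFn n := ⟨coord i, isSmooth_coord i⟩

/-- Evaluation of smooth functions at a point. -/
def evalAt (p : Sph n) : SmoothFn n →+* ℝ := ContMDiffMap.evalRingHom p

theorem evalAt_apply (p : Sph n) (f : SmoothFn n) : evalAt p f = f p := rfl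

theorem evalAt_algebraMap (p : Sph n) (r : ℝ) : evalAt p (algebraMap ℝ (SmoothFn n) r) = r := rfl

theorem evalAt_frameDerivation (p : Sph n) (i : Fin (n + 1)) (f : SmoothFn n) :
    evalAt p (frameDerivation i f) = frameDeriv i f p := rfl

theorem evalAt_coordFn (p : Sph n) (i : Fin (n + 1)) : evalAt p (coordFn i) = coord i p := rfl

theorem ext_evalAt {f g : SmoothFn n} (h : ∀ p, evalAt p f = evalAt p g) : f = g :=
  ContMDiffMap.ext h

theorem sphereFrame : SphereFrame (coordFn (n := n)) frameDerivation where
  sum_mul_self := ext_evalAt fun p => by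
    simpa only [map_sum, map_mul, map_one, evalAt_coordFn] using sum_coord_mul_self p
  sum_mul_apply f := ext_evalAt fun p => by
    simpa only [map_sum, map_mul, map_zero, evalAt_coordFn, evalAt_frameDerivation] using
      sum_coord_mul_frameDeriv f p
  apply_coord i j := ext_evalAt fun p => by
    rw [map_sub, map_mul, evalAt_frameDerivation, apply_ite (evalAt p), map_one, map_zero]
    exact frameDeriv_coord i j p

theorem gradNormSq_coe (f : SmoothFn n) : gradNormSq f = gam frameDerivation f f := by
  funext p
  rw [← evalAt_apply, gam, map_sum, gradNormSq_eq_sum]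
  rfl

theorem laplacian_coe (f : SmoothFn n) : laplacian f = lap frameDerivation f := by
  funext p
  rw [← evalAt_apply, lap, map_sum, laplacian_eq_sum f.contMDiff]
  rfl

theorem formDivergence_coe (f g : SmoothFn n) (p : Sph n) :
    formDivergence (fun q => f q • differential g q) p =
      evalAt p (f * lap frameDerivation g + gam frameDerivation f g) := by
  rw [formDivergence_smul_differential f.contMDiff g.contMDiff]
  have h : f * lap frameDerivation g + gam frameDerivation f g =
      ∑ i, frameDerivation i (f * frameDerivation i g) := by
    simp only [lap, gam, Derivation.leibniz, smul_eq_mul, Finset.mul_sum,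
      ← Finset.sum_add_distrib]
    exact Finset.sum_congr rfl fun i _ => by ring
  rw [h, map_sum]
  rfl

/-- The trilinear form on `C^∞(S^n)` underlying the `σ₂`-operator. -/
def sigmaTwoForm (u v w : SmoothFn n) : SmoothFn n :=
  trilin frameDerivation (algebraMap ℝ _ (1 / 2)) (algebraMap ℝ _ (((n : ℝ) - 4) / 16))
    (algebraMap ℝ _ (((n : ℝ) - 1) / 4 * (((n : ℝ) - 4) / 4) ^ 2))
    (algebraMap ℝ _ ((n : ℝ) * ((n : ℝ) - 1) / 8 * (((n : ℝ) - 4) / 4) ^ 3)) u v w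

theorem sigmaTwoCubic_coe (f : SmoothFn n) : sigmaTwoCubic f = sigmaTwoForm f f f := by
  funext p
  have hsq : ((f : Sph n → ℝ) ^ 2) = (f * f : SmoothFn n) := by
    rw [sq]; rfl
  rw [← evalAt_apply, sigmaTwoCubic, gradNormSq_coe, laplacian_coe, formDivergence_coe, hsq,
    laplacian_coe, formDivergence_coe, sigmaTwoForm, trilin]
  simp only [map_add, map_sub, map_mul, map_pow, evalAt_algebraMap]
  simp only [evalAt_apply]
  ring

theorem sigmaTwoForm_polarization (u v : SmoothFn n) :
    sigmaTwoForm (v + u + u) (v + u + u) (v + u + u) - sigmaTwoForm (v + u) (v + u) (v + u)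
        - sigmaTwoForm (u + u) (u + u) (u + u) - sigmaTwoForm (v + u) (v + u) (v + u)
        + sigmaTwoForm v v v + sigmaTwoForm u u u + sigmaTwoForm u u u =
      2 * (sigmaTwoForm v u u + sigmaTwoForm u v u + sigmaTwoForm u u v) :=
  trilin_polarization _ _ _ _ _ u v

theorem sum_coord_mul_sigmaTwoForm (u : SmoothFn n) (p : Sph n) :
    ∑ i, coord i p * (evalAt p (sigmaTwoForm (coordFn i * u) u u)
        + evalAt p (sigmaTwoForm u (coordFn i * u) u)
        + evalAt p (sigmaTwoForm u u (coordFn i * u))) =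
      3 * evalAt p (sigmaTwoForm u u u)
        - 1 / 2 * (((n : ℝ) + 2) * (evalAt p u * evalAt p (gam frameDerivation u u)))
        - ((n : ℝ) - 4) / 16 * ((4 * n + 4) * (evalAt p u * evalAt p (gam frameDerivation u u))
          + (4 * n - 4) * (evalAt p u ^ 2 * evalAt p (lap frameDerivation u)))
        + 2 * (((n : ℝ) - 1) / 4 * (((n : ℝ) - 4) / 4) ^ 2) * n * evalAt p u ^ 3 := by
  have h := congrArg (evalAt p) ((sphereFrame (n := n)).sum_coord_mul_trilin
    (algebraMap ℝ _ (1 / 2)) (algebraMap ℝ _ (((n : ℝ) - 4) / 16))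
    (algebraMap ℝ _ (((n : ℝ) - 1) / 4 * (((n : ℝ) - 4) / 4) ^ 2))
    (algebraMap ℝ _ ((n : ℝ) * ((n : ℝ) - 1) / 8 * (((n : ℝ) - 4) / 4) ^ 3)) u n (by simp))
  simp only [map_sum, map_mul, map_sub, map_add, map_pow, map_natCast, map_ofNat,
    evalAt_algebraMap, evalAt_coordFn] at h
  simpa only [sigmaTwoForm, map_mul, map_pow] using h

theorem sigmaTwoOp_coe (u v : SmoothFn n) (p : Sph n) :
    sigmaTwoOp v u u p =
      1 / 3 * evalAt p (sigmaTwoForm v u u + sigmaTwoForm u v u + sigmaTwoForm u u v) := by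
  have h1 : sigmaTwoOp v u u p = 1 / 6 * evalAt p
      (sigmaTwoForm (v + u + u) (v + u + u) (v + u + u) - sigmaTwoForm (v + u) (v + u) (v + u)
        - sigmaTwoForm (u + u) (u + u) (u + u) - sigmaTwoForm (v + u) (v + u) (v + u)
        + sigmaTwoForm v v v + sigmaTwoForm u u u + sigmaTwoForm u u u) := by
    simp only [sigmaTwoOp, polarization, ← ContMDiffMap.coe_add, sigmaTwoCubic_coe]
    rfl
  rw [h1, sigmaTwoForm_polarization, map_mul, map_ofNat]
  ring

end RoundSphere

end

open RoundSphere

theorem theorem1p4 (n : ℕ) (u : RoundSphere.Sph n → ℝ) (hu : RoundSphere.IsSmooth u)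
    (p : RoundSphere.Sph n) :
    ∑ i : Fin (n + 1),
        RoundSphere.coord i p *
          RoundSphere.commutator RoundSphere.sigmaTwoOp (RoundSphere.coord i) u p =
      ((n : ℝ) - 1) / 3 * u p * RoundSphere.sigmaOne u p := by
  let f : SmoothFn n := ⟨u, hu⟩
  have hcomm : ∀ i, commutator sigmaTwoOp (coord i) u p =
      1 / 3 * evalAt p (sigmaTwoForm (coordFn i * f) f f + sigmaTwoForm f (coordFn i * f) f
        + sigmaTwoForm f f (coordFn i * f)) - coord i p * evalAt p (sigmaTwoForm f f f) :=
    fun i => by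
      have h1 := sigmaTwoOp_coe f (coordFn i * f) p
      have h2 := sigmaTwoOp_coe f f p
      simp only [map_add] at h1 h2 ⊢
      change sigmaTwoOp (coordFn i * f : SmoothFn n) f f p - coord i p * sigmaTwoOp f f f p = _
      rw [h1, h2]
      ring
  have hsplit : ∑ i, coord i p * commutator sigmaTwoOp (coord i) u p =
      1 / 3 * ∑ i, coord i p * (evalAt p (sigmaTwoForm (coordFn i * f) f f)
        + evalAt p (sigmaTwoForm f (coordFn i * f) f)
        + evalAt p (sigmaTwoForm f f (coordFn i * f)))
      - (∑ i, coord i p * coord i p) * evalAt p (sigmaTwoForm f f f) := by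
    simp only [hcomm, map_add, Finset.mul_sum, Finset.sum_mul, ← Finset.sum_sub_distrib]
    exact Finset.sum_congr rfl fun i _ => by ring
  have hgrad : gradNormSq u p = evalAt p (gam frameDerivation f f) :=
    congrFun (gradNormSq_coe f) p
  have hlap : laplacian (u ^ 2) p =
      2 * (u p * evalAt p (lap frameDerivation f)) + 2 * evalAt p (gam frameDerivation f f) := by
    have hsq : u ^ 2 = (f * f : SmoothFn n) := by rw [sq]; rfl
    rw [hsq, laplacian_coe, ← evalAt_apply, lap_mul]
    simp only [map_add, map_mul, map_ofNat]
    change u p * _ + u p * _ + _ = _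
    ring
  have hfu : evalAt p f = u p := rfl
  -- The copies of `L_{σ₂}(u,u,u)` cancel. For `u|∇u|²` the match is `(n+2)/2 + (n-4)(n+1)/4 =
  -- n(n-1)/4`.
  rw [hsplit, sum_coord_mul_sigmaTwoForm, sum_coord_mul_self, sigmaOne, hgrad, hlap, hfu]
  ring
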